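/- Let $\mathcal G=(\mathcal V,\mathcal E)$ be an infinite connected simple undirected graph with arc set $\mathcal A=\mathcal A(\mathcal G)$ (each edge $\{i,j\}$ gives the two mutually inverse arcs $i\to j$ and $j\to i$; the inverse of $a$ is written $\bar a$), and let each site $v$ carry a probability $p_v\in(0,1]$. The weighted Hashimoto matrix of $(\mathcal G,p)$ is the matrix indexed by arcs with entries $(H_p)_{ab}=p_j\,\delta_{j,j'}\,(1-\delta_{i,l})$ for $a=i\to j$, $b=j'\to l$. Suppose that the oriented line graph of $\mathcal G$ is locally strongly connected: there is an $\ell$ such that for every arc $a\in\mathcal A$ there is a non-backtracking walk of length at most $\ell$ from $a$ to $\bar a$, i.e. a sequence of at most $\ell$ steps, each going from an arc $i\to j$ to an arc $j\to l$ with $l\neq i$. Suppose that there is a constant $p_{\min}$ with $p_v>p_{\min}>0$ for all $v$. Let $\mathcal G^{(1)}\subset\mathcal G^{(2)}\subset\dots\subset\mathcal G$ be any increasing sequence of finite subgraphs without leaves (degree-one vertices) that converges to $\mathcal G$ near some origin $v_0\in\mathcal V$: for every $R>0$ there is $t_0$ such that for all $t\ge t_0$ the radius-$R$ vicinity of $v_0$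 in $\mathcal G$ is isomorphic to a subgraph of $\mathcal G^{(t)}$, with equal site probabilities at corresponding sites. Let $H_p^{(t)}$ be the weighted Hashimoto matrix of $\mathcal G^{(t)}$ with the site probabilities of $\mathcal G$, and $\rho(H_p^{(t)})$ its spectral radius (the largest absolute value of a complex eigenvalue). Then $$\lim_{t\to\infty}\rho\bigl(H_p^{(t)}\bigr)=\rho_{l^2}(H_p),$$ where $\rho_{l^2}(H_p)=\sup\{|\lambda|:\lambda\in\sigma(H_p)\}$ is the spectral radius of $H_p$ as a bounded operator on the complex Hilbert space $l^2(\mathcal A)$; if $H_p$ is not bounded on $l^2(\mathcal A)$, we set $\rho_{l^2}(H_p)=\infty$, and the claim is that $\rho(H_p^{(t)})\to\infty$. -/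

import Mathlib

open Filter Topology
open scoped ENNReal

noncomputable section

namespace SitePercolation

/-- Adjacency in the oriented line graph: its vertices are the arcs of `G` (Mathlib's `G.Dart`),
and there is an edge from `a = i → j` to `b = j' → l` iff `j = j'` and `i ≠ l`. -/
def OLGAdj {V : Type*} {G : SimpleGraph V} (a b : G.Dart) : Prop :=
  a.snd = b.fst ∧ a.fst ≠ b.snd

/-- There is a non-backtracking walk with `k` steps from the arc `a` to the arc `b`, that is,
a directed walk of length `k` in the oriented line graph. -/
def HasNonBacktrackingWalk {V : Type*} {G : SimpleGraph V} (a b : G.Dart) (k : ℕ) : Prop :=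
  ∃ w : Fin (k + 1) → G.Dart, w 0 = a ∧ w (Fin.last k) = b ∧
    ∀ i : Fin k, OLGAdj (w i.castSucc) (w i.succ)

/-- The oriented line graph of `G` is locally strongly connected: for some `ℓ`, every arc is joined
to its inverse by a non-backtracking walk of length at most `ℓ`. -/
def LocallyStronglyConnectedOLG {V : Type*} (G : SimpleGraph V) : Prop :=
  ∃ ℓ : ℕ, ∀ a : G.Dart, ∃ k : ℕ, k ≤ ℓ ∧ HasNonBacktrackingWalk a a.symm k

open Classical in
/-- The weighted Hashimoto (non-backtracking) matrix `H_p`: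
for arcs `a = i → j` and `b = j' → l`, `(H_p)_{ab} = p_j δ_{j j'} (1 - δ_{i l})`. -/
def hashimoto {V : Type*} (G : SimpleGraph V) (p : V → ℝ) : Matrix G.Dart G.Dart ℝ :=
  fun a b => if OLGAdj a b then p a.snd else 0

open Classical in
/-- The spectral radius `max |λ_i(B)|` of a finite real square matrix, the `λ_i(B)` being its
complex eigenvalues (it is `0` for the empty matrix). -/
def matrixSpectralRadius {ι : Type*} [Finite ι] (B : Matrix ι ι ℝ) : ℝ≥0∞ :=
  letI : Fintype ι := Fintype.ofFinite ι
  spectralRadius ℂ (B.map (fun x : ℝ => (x : ℂ)))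

open Classical in
/-- `T` is the bounded operator on `ℓ²(ι)` whose matrix in the standard basis is `B`. -/
def IsL2Operator {ι : Type*} (B : Matrix ι ι ℝ)
    (T : lp (fun _ : ι => ℂ) 2 →L[ℂ] lp (fun _ : ι => ℂ) 2) : Prop :=
  ∀ a b : ι, T (lp.single 2 b (1 : ℂ)) a = (B a b : ℂ)

/-- A matrix represents at most one bounded operator on `ℓ²`. -/
theorem IsL2Operator.unique {ι : Type*} {B : Matrix ι ι ℝ}
    {T S : lp (fun _ : ι => ℂ) 2 →L[ℂ] lp (fun _ : ι => ℂ) 2}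
    (hT : IsL2Operator B T) (hS : IsL2Operator B S) : T = S := by
  classical
  have hb : ∀ (b : ι) (z : ℂ), T (lp.single 2 b z) = S (lp.single 2 b z) := by
    intro b z
    have h1 : T (lp.single 2 b (1 : ℂ)) = S (lp.single 2 b (1 : ℂ)) := by
      ext a
      have h := (hT a b).trans (hS a b).symm
      convert h
    have hz : lp.single (E := fun _ : ι => ℂ) 2 b z = z • lp.single 2 b (1 : ℂ) := by
      rw [← lp.single_smul]; simp
    rw [hz, map_smul, map_smul, h1]
  ext1 f
  have hf := lp.hasSum_single (E := fun _ : ι => ℂ) (p := 2) (by norm_num) f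
  have h2 := hf.mapL T
  have h3 := hf.mapL S
  simp only [hb] at h2
  exact h2.unique h3

/-- The `ℓ²` spectral radius `ρ_{ℓ²}(B) = sup {|λ| : λ ∈ σ(B)}` of the operator with matrix `B`
acting on the complex Hilbert space `ℓ²(ι)`. The infimum ranges over the at most one bounded
operator with matrix `B`; the value is `∞` if `B` is not bounded on `ℓ²(ι)`. -/
def l2SpectralRadius {ι : Type*} (B : Matrix ι ι ℝ) : ℝ≥0∞ :=
  ⨅ (T : lp (fun _ : ι => ℂ) 2 →L[ℂ] lp (fun _ : ι => ℂ) 2) (_ : IsL2Operator B T),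
    spectralRadius ℂ T

theorem l2SpectralRadius_eq {ι : Type*} {B : Matrix ι ι ℝ}
    {T : lp (fun _ : ι => ℂ) 2 →L[ℂ] lp (fun _ : ι => ℂ) 2} (hT : IsL2Operator B T) :
    l2SpectralRadius B = spectralRadius ℂ T :=
  le_antisymm (iInf₂_le T hT) (le_iInf₂ fun S hS => by rw [hT.unique hS])

/-- The sequence of graphs `G' t` with site probabilities `p' t` converges near the origin `v₀` to
`G` with site probabilities `p`: for every radius `R`, the radius-`R` vicinity of `v₀` in `G` is,
for all large `t`, isomorphic to a subgraph of `G' t`, with matching site probabilities. -/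
def ConvergesNear {V : Type*} (G : SimpleGraph V) (p : V → ℝ) (v₀ : V) {W : ℕ → Type*}
    (G' : ∀ t, SimpleGraph (W t)) (p' : ∀ t, W t → ℝ) : Prop :=
  ∀ R : ℕ, ∃ t₀ : ℕ, ∀ t ≥ t₀,
    ∃ f : SimpleGraph.Copy (G.induce {v | G.edist v₀ v ≤ R}) (G' t), ∀ v, p' t (f v) = p v

instance {V : Type*} [Finite V] (G : SimpleGraph V) : Finite G.Dart :=
  Finite.of_injective (fun a : G.Dart => a.toProd) fun a b h => SimpleGraph.Dart.ext a b h

end SitePercolation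

end

/-! Let $\rho_R$ be the spectral radius of the truncation of $H$ to the arcs of the ball of radius
$R$. Entrywise domination of nonnegative matrices passes to powers and to their norms, hence by
Gelfand's formula to spectral radii. So $\rho(H^{(t)}) \le \rho_{l^2}(H)$ for all $t$, and $\rho_R
\le \rho(H^{(t)})$ for large $t$. It remains to show $\rho_{l^2}(H) \le L := \sup_R \rho_R$
(`l2SpectralRadius_le_iSup`).

The matrices are not normal, so norms of powers must be controlled otherwise. Let $\sigma$ be arc
reversal, and let $A$, $B$ be the truncations to radii $R$ and $R+\ell$. Reversal transposes $A$, so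
$A^n\sigma$ is symmetric and its norm, which is that of $A^n$, equals its spectral radius. Local
strong connectedness replaces $\sigma$ by walks: $q^\ell A^n\sigma \le B^n \sum_{k\le\ell} B^k$
entrywise, with $q$ a lower bound for the site probabilities. Hence $\|A^n\| \le M L^n$ with $M$
independent of $R$ and $n$ (`formBound_tpow_ballHashimoto`). Exhaustion by balls gives $\|H^n\| \le
M L^n$, and Gelfand's formula finishes the proof. -/

namespace SitePercolation

/-! ### Nonnegative matrices as operators on `ℓ²`. -/

/-- The complex Hilbert space `ℓ²(ι)`. -/
noncomputable abbrev L2 (ι : Type*) := lp (fun _ : ι => ℂ) 2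

/-- The bilinear form of `B` is bounded by `C` on nonnegative finitely supported vectors. -/
def FormBound {ι : Type*} (B : Matrix ι ι ℝ) (C : ℝ) : Prop :=
  ∀ (s u : Finset ι) (g f : ι → ℝ), 0 ≤ g → 0 ≤ f →
    ∑ a ∈ s, ∑ b ∈ u, g a * B a b * f b ≤ C * √(∑ a ∈ s, g a ^ 2) * √(∑ b ∈ u, f b ^ 2)

open Classical in
/-- Powers of a possibly infinite matrix, the products being given by `tsum`. -/
noncomputable def tpow {ι : Type*} (B : Matrix ι ι ℝ) : ℕ → Matrix ι ι ℝ
  | 0 => fun a b => if a = b then 1 else 0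
  | n + 1 => fun a b => ∑' c, tpow B n a c * B c b

variable {ι κ : Type*}

namespace IsL2Operator

theorem apply_single {B : Matrix ι ι ℝ} {T : L2 ι →L[ℂ] L2 ι} [DecidableEq ι]
    (hT : IsL2Operator B T) (a b : ι) (z : ℂ) :
    T (lp.single 2 b z) a = B a b * z := by
  have hz : lp.single (E := fun _ : ι => ℂ) 2 b z = z • lp.single 2 b (1 : ℂ) := by
    rw [← lp.single_smul]; simp
  obtain rfl : ‹DecidableEq ι› = fun a b => Classical.propDecidable (a = b) :=
    Subsingleton.elim _ _
  rw [hz, map_smul, lp.coeFn_smul, Pi.smul_apply, smul_eq_mul, mul_comm, ← hT a b]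

theorem hasSum_apply {B : Matrix ι ι ℝ} {T : L2 ι →L[ℂ] L2 ι}
    (hT : IsL2Operator B T) (f : L2 ι) (a : ι) :
    HasSum (fun b => (B a b : ℂ) * f b) (T f a) := by
  classical
  have h := ((lp.hasSum_single (E := fun _ : ι => ℂ) (p := 2) (by norm_num) f).mapL T).mapL
    (lp.evalCLM ℂ (fun _ : ι => ℂ) 2 a)
  simpa [lp.evalCLM, hT.apply_single] using h

theorem hasSum_mul {A B : Matrix ι ι ℝ} {T S : L2 ι →L[ℂ] L2 ι}
    (hT : IsL2Operator A T) (hS : IsL2Operator B S) (a b : ι) [DecidableEq ι] :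
    HasSum (fun c => (A a c * B c b : ℝ)) ((T * S) (lp.single 2 b (1 : ℂ)) a).re := by
  have h := hT.hasSum_apply (S (lp.single 2 b (1 : ℂ))) a
  simp only [hS.apply_single, mul_one] at h
  simpa using Complex.hasSum_re h

theorem summable_mul {A B : Matrix ι ι ℝ} {T S : L2 ι →L[ℂ] L2 ι}
    (hT : IsL2Operator A T) (hS : IsL2Operator B S) (a b : ι) :
    Summable (fun c => (A a c * B c b : ℝ)) := by
  classical exact (hT.hasSum_mul hS a b).summable

theorem mul {A B : Matrix ι ι ℝ} {T S : L2 ι →L[ℂ] L2 ι}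
    (hT : IsL2Operator A T) (hS : IsL2Operator B S) :
    IsL2Operator (fun a b => ∑' c, A a c * B c b) (T * S) := by
  classical
  intro a b
  have h := hT.hasSum_apply (S (lp.single 2 b (1 : ℂ))) a
  simp only [hS.apply_single, mul_one] at h
  have h2 := Complex.hasSum_ofReal.2 (hT.summable_mul hS a b).hasSum
  simp only [Complex.ofReal_mul] at h2
  rw [← h.unique h2]
  rfl

theorem tpow {B : Matrix ι ι ℝ} {T : L2 ι →L[ℂ] L2 ι} (hT : IsL2Operator B T) (n : ℕ) :
    IsL2Operator (tpow B n) (T ^ n) := by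
  classical
  induction n with
  | zero =>
    intro a b
    rw [pow_zero, SitePercolation.tpow]
    change (lp.single (E := fun _ : ι => ℂ) 2 b (1 : ℂ)) a = _
    rw [lp.single_apply]
    by_cases h : a = b <;> simp [h]
  | succ n ih => rw [pow_succ]; exact ih.mul hT

theorem formBound {B : Matrix ι ι ℝ} {T : L2 ι →L[ℂ] L2 ι} (hT : IsL2Operator B T) :
    FormBound B ‖T‖ := by
  classical
  intro s u g f hg hf
  have hn : ∀ (s : Finset ι) (g : ι → ℝ),
      ‖∑ a ∈ s, lp.single (E := fun _ : ι => ℂ) 2 a (g a : ℂ)‖ = √(∑ a ∈ s, g a ^ 2) := by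
    intro s g
    have h := lp.norm_sum_single (E := fun _ : ι => ℂ) (p := 2) (by norm_num)
      (fun a => (g a : ℂ)) s
    simp only [ENNReal.toReal_ofNat, Real.rpow_ofNat, Complex.norm_real, Real.norm_eq_abs,
      sq_abs] at h
    rw [← h, Real.sqrt_sq (norm_nonneg _)]
  set x : L2 ι := ∑ b ∈ u, lp.single 2 b (f b : ℂ) with hx
  set y : L2 ι := ∑ a ∈ s, lp.single 2 a (g a : ℂ) with hy
  have hin : inner ℂ y (T x) = ((∑ a ∈ s, ∑ b ∈ u, g a * B a b * f b : ℝ) : ℂ) := by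
    rw [hy, sum_inner]
    push_cast
    refine Finset.sum_congr rfl fun a _ => ?_
    rw [lp.inner_single_left, hx, map_sum, lp.coeFn_sum, Finset.sum_apply]
    simp only [hT.apply_single, RCLike.inner_apply, Complex.conj_ofReal, Finset.sum_mul]
    exact Finset.sum_congr rfl fun b _ => by ring
  calc _ ≤ ‖((∑ a ∈ s, ∑ b ∈ u, g a * B a b * f b : ℝ) : ℂ)‖ := by
        rw [Complex.norm_real]; exact le_abs_self _
    _ = ‖inner ℂ y (T x)‖ := by rw [hin]
    _ ≤ ‖y‖ * ‖T x‖ := norm_inner_le_norm _ _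
    _ ≤ ‖y‖ * (‖T‖ * ‖x‖) := by gcongr; exact T.le_opNorm x
    _ = _ := by rw [hx, hy, hn, hn]; ring

end IsL2Operator

/-- Test the form against the row sums `r` themselves and cancel one factor `√X`. -/
theorem FormBound.sum_sq_le {B : Matrix ι ι ℝ} {C : ℝ} (hB : ∀ a b, 0 ≤ B a b) (hC : 0 ≤ C)
    (h : FormBound B C) (s u : Finset ι) (f : L2 ι) :
    ∑ a ∈ s, (∑ b ∈ u, B a b * ‖f b‖) ^ 2 ≤ (C * ‖f‖) ^ 2 := by
  set r : ι → ℝ := fun a => ∑ b ∈ u, B a b * ‖f b‖ with hr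
  have hr0 : 0 ≤ r := fun a => Finset.sum_nonneg fun b _ => mul_nonneg (hB a b) (norm_nonneg _)
  have h1 := h s u r (fun b => ‖f b‖) hr0 (fun b => norm_nonneg _)
  have h2 : ∑ a ∈ s, ∑ b ∈ u, r a * B a b * ‖f b‖ = ∑ a ∈ s, r a ^ 2 := by
    refine Finset.sum_congr rfl fun a _ => ?_
    rw [sq]
    conv_rhs => rw [hr]
    simp only [Finset.mul_sum, Finset.sum_mul]
    simp only [hr, Finset.sum_mul, mul_assoc]

  have h3 : √(∑ b ∈ u, ‖f b‖ ^ 2) ≤ ‖f‖ := by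
    refine Real.sqrt_le_iff.2 ⟨norm_nonneg _, ?_⟩
    have := lp.sum_rpow_le_norm_rpow (p := 2) (by norm_num) f u
    simpa using this
  rw [h2] at h1
  set X := ∑ a ∈ s, r a ^ 2
  have hX : 0 ≤ X := Finset.sum_nonneg fun _ _ => sq_nonneg _
  have h4 : √X * √X ≤ √X * (C * ‖f‖) := by
    rw [Real.mul_self_sqrt hX]
    refine h1.trans ?_
    calc _ ≤ C * √X * ‖f‖ := by gcongr
      _ = _ := by ring
  have h5 : √X ≤ C * ‖f‖ := by
    rcases (Real.sqrt_nonneg X).eq_or_lt with h0 | h0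
    · rw [← h0]; positivity
    · exact le_of_mul_le_mul_left h4 h0
  exact (Real.sqrt_le_left (by positivity)).1 h5

/-- Nonnegative test vectors suffice because `|B f| ≤ B |f|` entrywise; the same bound makes every
row sum absolutely convergent. -/
theorem FormBound.exists_operator {B : Matrix ι ι ℝ} {C : ℝ} (hB : ∀ a b, 0 ≤ B a b) (hC : 0 ≤ C)
    (h : FormBound B C) : ∃ T : L2 ι →L[ℂ] L2 ι, IsL2Operator B T ∧ ‖T‖ ≤ C := by
  classical
  have hsn : ∀ (f : L2 ι) a, Summable fun b => ‖(B a b : ℂ) * f b‖ := by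
    intro f a
    refine summable_of_sum_le (c := C * ‖f‖) (fun b => norm_nonneg _) fun u => ?_
    have := h.sum_sq_le hB hC {a} u f
    rw [Finset.sum_singleton] at this
    have := abs_le_of_sq_le_sq' this (by positivity)
    simpa [abs_of_nonneg (hB _ _)] using this.2
  have hs : ∀ (f : L2 ι) a, Summable fun b => (B a b : ℂ) * f b := fun f a => (hsn f a).of_norm
  have hle : ∀ (f : L2 ι) (s : Finset ι),
      ∑ a ∈ s, ‖∑' b, (B a b : ℂ) * f b‖ ^ 2 ≤ (C * ‖f‖) ^ 2 := by
    intro f s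
    have ht : Tendsto (fun u : Finset ι => ∑ a ∈ s, ‖∑ b ∈ u, (B a b : ℂ) * f b‖ ^ 2) atTop
        (𝓝 (∑ a ∈ s, ‖∑' b, (B a b : ℂ) * f b‖ ^ 2)) :=
      tendsto_finsetSum _ fun a _ => ((hs f a).hasSum.norm).pow 2
    refine le_of_tendsto' ht fun u => (Finset.sum_le_sum fun a _ => ?_).trans
      (h.sum_sq_le hB hC s u f)
    gcongr
    refine (norm_sum_le _ _).trans (Finset.sum_le_sum fun b _ => ?_)
    simp [abs_of_nonneg (hB _ _)]
  have hmem : ∀ f : L2 ι, Memℓp (fun a => ∑' b, (B a b : ℂ) * f b) 2 := by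
    intro f
    refine memℓp_gen (summable_of_sum_le (c := (C * ‖f‖) ^ 2) (fun a => by positivity) fun u => ?_)
    simpa using hle f u
  let T₀ : L2 ι →ₗ[ℂ] L2 ι :=
    { toFun := fun f => ⟨fun a => ∑' b, (B a b : ℂ) * f b, hmem f⟩
      map_add' := fun f g => by
        ext a
        change ∑' b, (B a b : ℂ) * (f + g) b = (∑' b, (B a b : ℂ) * f b) + ∑' b, (B a b : ℂ) * g b
        rw [← (hs f a).tsum_add (hs g a)]
        simp [mul_add]
      map_smul' := fun z f => by
        ext a
        change ∑' b, (B a b : ℂ) * (z • f) b = z * ∑' b, (B a b : ℂ) * f b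
        rw [← tsum_mul_left]
        refine tsum_congr fun b => ?_
        simp only [lp.coeFn_smul, Pi.smul_apply, smul_eq_mul]
        ring }
  have hT₀ : ∀ f, ‖T₀ f‖ ≤ C * ‖f‖ := by
    intro f
    refine lp.norm_le_of_forall_sum_le (p := 2) (by norm_num) (by positivity) fun s => ?_
    simp only [ENNReal.toReal_ofNat, Real.rpow_ofNat]
    exact hle f s
  refine ⟨T₀.mkContinuous C hT₀, ?_, T₀.mkContinuous_norm_le hC hT₀⟩
  intro a b
  change ∑' c, (B a c : ℂ) * (lp.single 2 b (1 : ℂ) : L2 ι) c = _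
  rw [tsum_eq_single b]
  · simp
  · intro c hc
    simp [lp.single_apply, hc]

theorem IsL2Operator.norm_le {B : Matrix ι ι ℝ} {T : L2 ι →L[ℂ] L2 ι} {C : ℝ}
    (hT : IsL2Operator B T) (hB : ∀ a b, 0 ≤ B a b) (hC : 0 ≤ C) (h : FormBound B C) :
    ‖T‖ ≤ C := by
  obtain ⟨S, hS, hSC⟩ := h.exists_operator hB hC
  rwa [hT.unique hS]

/-- Domination of the entries of `A` by entries of `B` transports bounds from `B` to `A`. -/
theorem FormBound.of_le {A : Matrix ι ι ℝ} {B : Matrix κ κ ℝ} {C : ℝ} (φ ψ : ι ↪ κ)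
    (hAB : ∀ a b, A a b ≤ B (φ a) (ψ b)) (h : FormBound B C) : FormBound A C := by
  intro s u g f hg hf
  -- Extension by zero. Rows and columns may be embedded differently, so permuting only the columns
  -- is covered.
  have h1 := h (s.map φ) (u.map ψ) (Function.extend φ g 0) (Function.extend ψ f 0)
    (fun a => by
      by_cases ha : ∃ b, φ b = a
      · obtain ⟨b, rfl⟩ := ha; rw [φ.injective.extend_apply]; exact hg b
      · rw [Function.extend_apply' _ _ _ ha])
    (fun a => by
      by_cases ha : ∃ b, ψ b = a
      · obtain ⟨b, rfl⟩ := ha; rw [ψ.injective.extend_apply]; exact hf b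
      · rw [Function.extend_apply' _ _ _ ha])
  simp only [Finset.sum_map, φ.injective.extend_apply, ψ.injective.extend_apply] at h1
  refine le_trans ?_ h1
  refine Finset.sum_le_sum fun a _ => Finset.sum_le_sum fun b _ => ?_
  exact mul_le_mul_of_nonneg_right (mul_le_mul_of_nonneg_left (hAB a b) (hg a)) (hf b)

theorem FormBound.const_mul_iff {B : Matrix ι ι ℝ} {C c : ℝ} (hc : 0 < c) :
    FormBound (fun a b => c * B a b) (c * C) ↔ FormBound B C := by
  refine forall_congr' fun s => forall_congr' fun u => forall_congr' fun g => forall_congr' fun f =>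
    forall_congr' fun _ => forall_congr' fun _ => ?_
  have : ∑ a ∈ s, ∑ b ∈ u, g a * (c * B a b) * f b = c * ∑ a ∈ s, ∑ b ∈ u, g a * B a b * f b := by
    simp only [Finset.mul_sum]
    exact Finset.sum_congr rfl fun a _ => Finset.sum_congr rfl fun b _ => by ring
  rw [this, mul_assoc c, mul_assoc c, mul_le_mul_iff_right₀ hc]

/-! ### Monotonicity and estimates of spectral radii. -/

theorem tpow_nonneg {B : Matrix ι ι ℝ} (hB : ∀ a b, 0 ≤ B a b) (n : ℕ) (a b : ι) :
    0 ≤ tpow B n a b := by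
  induction n generalizing b with
  | zero => simp only [tpow]; split_ifs <;> norm_num
  | succ n ih => exact tsum_nonneg fun c => mul_nonneg (ih c) (hB c b)

/-- The operators serve only to make the sums converge: a divergent `tsum` has value `0` and would
break monotonicity. -/
theorem tpow_le_tpow {A : Matrix ι ι ℝ} {B : Matrix κ κ ℝ} {T : L2 ι →L[ℂ] L2 ι}
    {S : L2 κ →L[ℂ] L2 κ} (hA : ∀ a b, 0 ≤ A a b) (hB : ∀ a b, 0 ≤ B a b)
    (hT : IsL2Operator A T) (hS : IsL2Operator B S) (φ : ι ↪ κ)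
    (hAB : ∀ a b, A a b ≤ B (φ a) (φ b)) (n : ℕ) (a b : ι) :
    tpow A n a b ≤ tpow B n (φ a) (φ b) := by
  induction n generalizing b with
  | zero => by_cases h : a = b <;> simp [tpow, h]
  | succ n ih =>
    refine Summable.tsum_le_tsum_of_inj φ φ.injective ?_ ?_ ?_ ?_
    · exact fun c _ => mul_nonneg (tpow_nonneg hB n _ _) (hB _ _)
    · exact fun c => mul_le_mul (ih c) (hAB c b) (hA c b) (tpow_nonneg hB n _ _)
    · exact (hT.tpow n).summable_mul hT a b
    · exact (hS.tpow n).summable_mul hS (φ a) (φ b)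

/-- The spectral radius is monotone in the entries of a nonnegative matrix, also along an
inclusion of index sets. -/
theorem spectralRadius_le_of_le {A : Matrix ι ι ℝ} {B : Matrix κ κ ℝ} {T : L2 ι →L[ℂ] L2 ι}
    {S : L2 κ →L[ℂ] L2 κ} (hA : ∀ a b, 0 ≤ A a b) (hB : ∀ a b, 0 ≤ B a b)
    (hT : IsL2Operator A T) (hS : IsL2Operator B S) (φ : ι ↪ κ)
    (hAB : ∀ a b, A a b ≤ B (φ a) (φ b)) : spectralRadius ℂ T ≤ spectralRadius ℂ S := by
  refine le_of_tendsto_of_tendsto' (spectrum.pow_nnnorm_pow_one_div_tendsto_nhds_spectralRadius T)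
    (spectrum.pow_nnnorm_pow_one_div_tendsto_nhds_spectralRadius S) fun n => ?_
  have h : ‖T ^ n‖ ≤ ‖S ^ n‖ := (hT.tpow n).norm_le (tpow_nonneg hA n) (norm_nonneg _)
    ((hS.tpow n).formBound.of_le φ φ (tpow_le_tpow hA hB hT hS φ hAB n))
  exact ENNReal.rpow_le_rpow (ENNReal.coe_le_coe.2 h) (by positivity)

theorem spectralRadius_le_of_norm_pow_le {A : Type*} [NormedRing A] [NormedAlgebra ℂ A]
    [CompleteSpace A] (T : A) {M L : ℝ} (hM : 0 < M) (hL : 0 ≤ L)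
    (h : ∀ n, ‖T ^ n‖ ≤ M * L ^ n) : spectralRadius ℂ T ≤ ENNReal.ofReal L := by
  have h1 : Tendsto (fun n : ℕ => ENNReal.ofReal (M ^ (1 / (n : ℝ)) * L)) atTop
      (𝓝 (ENNReal.ofReal L)) := by
    have h2 : Tendsto (fun n : ℕ => M ^ (1 / (n : ℝ)) * L) atTop (𝓝 (M ^ (0 : ℝ) * L)) :=
      (((Real.continuous_const_rpow hM.ne').tendsto 0).comp
        tendsto_one_div_atTop_nhds_zero_nat).mul_const L
    simp only [Real.rpow_zero, one_mul] at h2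
    exact ENNReal.tendsto_ofReal h2
  refine le_of_tendsto_of_tendsto
    (spectrum.pow_nnnorm_pow_one_div_tendsto_nhds_spectralRadius T) h1 ?_
  -- At `n = 0` the exponent `1 / n` is `0`, and extracting the root of `L ^ n` fails.
  filter_upwards [eventually_ge_atTop 1] with n hn
  have h3 : ((‖T ^ n‖₊ : ℝ≥0∞)) = ENNReal.ofReal ‖T ^ n‖ := by
    rw [ofReal_norm]; rfl
  rw [h3, ENNReal.ofReal_rpow_of_nonneg (norm_nonneg _) (by positivity)]
  refine ENNReal.ofReal_le_ofReal ?_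
  calc ‖T ^ n‖ ^ (1 / (n : ℝ)) ≤ (M * L ^ n) ^ (1 / (n : ℝ)) :=
        Real.rpow_le_rpow (norm_nonneg _) (h n) (by positivity)
    _ = M ^ (1 / (n : ℝ)) * L := by
        rw [Real.mul_rpow hM.le (by positivity), one_div, Real.pow_rpow_inv_natCast hL (by omega)]

/-- Spectral mapping for a polynomial with nonnegative coefficients, plus the triangle inequality.
-/
theorem spectralRadius_pow_mul_sum_le {A : Type*} [NormedRing A] [NormedAlgebra ℂ A]
    [CompleteSpace A] (T : A) (n l : ℕ) :
    spectralRadius ℂ (T ^ n * ∑ k ∈ Finset.range (l + 1), T ^ k) ≤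
      spectralRadius ℂ T ^ n * ∑ k ∈ Finset.range (l + 1), spectralRadius ℂ T ^ k := by
  nontriviality A
  let q : Polynomial ℂ := Polynomial.X ^ n * ∑ k ∈ Finset.range (l + 1), Polynomial.X ^ k
  have hq : T ^ n * ∑ k ∈ Finset.range (l + 1), T ^ k = Polynomial.aeval T q := by simp [q]
  rw [hq, spectralRadius,
    spectrum.map_polynomial_aeval_of_nonempty T q (spectrum.nonempty T)]
  refine iSup₂_le ?_
  rintro _ ⟨z, hz, rfl⟩
  have h1 : (‖z‖₊ : ℝ≥0∞) ≤ spectralRadius ℂ T := le_iSup₂ (f := fun k (_ : k ∈ spectrum ℂ T) =>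
    (‖k‖₊ : ℝ≥0∞)) z hz
  have h2 : ‖q.eval z‖₊ ≤ ‖z‖₊ ^ n * ∑ k ∈ Finset.range (l + 1), ‖z‖₊ ^ k := by
    simp only [q, Polynomial.eval_mul, Polynomial.eval_pow, Polynomial.eval_X,
      Polynomial.eval_finsetSum, nnnorm_mul, nnnorm_pow]
    gcongr
    refine (nnnorm_sum_le _ _).trans_eq ?_
    simp
  calc (‖q.eval z‖₊ : ℝ≥0∞) ≤ ((‖z‖₊ ^ n * ∑ k ∈ Finset.range (l + 1), ‖z‖₊ ^ k : NNReal) : ℝ≥0∞) :=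
        ENNReal.coe_le_coe.2 h2
    _ = (‖z‖₊ : ℝ≥0∞) ^ n * ∑ k ∈ Finset.range (l + 1), (‖z‖₊ : ℝ≥0∞) ^ k := by push_cast; rfl
    _ ≤ _ := by gcongr

/-! ### Finite matrices. -/

open Classical in
/-- A finite matrix acts on `ℓ²(ι)`, with the spectral radius of the matrix. -/
theorem exists_algEquiv [Fintype ι] :
    ∃ e : Matrix ι ι ℂ ≃ₐ[ℂ] (L2 ι →L[ℂ] L2 ι), ∀ (B : Matrix ι ι ℝ),
      IsL2Operator B (e (B.map (fun x : ℝ => (x : ℂ)))) := by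
  let e₁ : Matrix ι ι ℂ ≃ₐ[ℂ] (EuclideanSpace ℂ ι →L[ℂ] EuclideanSpace ℂ ι) :=
    (Matrix.toEuclideanCLM (n := ι) (𝕜 := ℂ)).toAlgEquiv
  let e₂ := ContinuousLinearEquiv.conjContinuousAlgEquiv
    (lpPiLpₗᵢ (p := 2) (fun _ : ι => ℂ) ℂ).symm.toContinuousLinearEquiv |>.toAlgEquiv
  refine ⟨e₁.trans e₂, fun B a b => ?_⟩
  change (Matrix.toEuclideanCLM (n := ι) (𝕜 := ℂ) (B.map (fun x : ℝ => (x : ℂ)))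
    (lpPiLpₗᵢ (fun _ : ι => ℂ) ℂ (lp.single 2 b (1 : ℂ)))).ofLp a = _
  rw [Matrix.ofLp_toEuclideanCLM]
  change Matrix.mulVec _ (⇑(lp.single (E := fun _ : ι => ℂ) 2 b (1 : ℂ))) a = _
  rw [lp.coeFn_single]
  simp

theorem exists_isL2Operator_of_finite [Finite ι] (B : Matrix ι ι ℝ) :
    ∃ T : L2 ι →L[ℂ] L2 ι, IsL2Operator B T ∧ spectralRadius ℂ T = matrixSpectralRadius B := by
  classical
  let _ : Fintype ι := Fintype.ofFinite ι
  obtain ⟨e, he⟩ := exists_algEquiv (ι := ι)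
  refine ⟨_, he B, ?_⟩
  unfold matrixSpectralRadius spectralRadius
  rw [AlgEquiv.spectrum_eq e]

theorem matrixSpectralRadius_eq [Finite ι] {B : Matrix ι ι ℝ} {T : L2 ι →L[ℂ] L2 ι}
    (hT : IsL2Operator B T) : matrixSpectralRadius B = spectralRadius ℂ T := by
  obtain ⟨S, hS, h⟩ := exists_isL2Operator_of_finite B
  rw [← h, hT.unique hS]

theorem matrixSpectralRadius_lt_top [Finite ι] (B : Matrix ι ι ℝ) :
    matrixSpectralRadius B < ⊤ := by
  obtain ⟨S, hS, h⟩ := exists_isL2Operator_of_finite B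
  rw [← h]
  exact (spectrum.spectralRadius_le_pow_nnnorm_pow_one_div ℂ S 0).trans_lt (by
    refine ENNReal.mul_lt_top ?_ ?_ <;> exact ENNReal.rpow_lt_top_of_nonneg (by simp) (by simp))

theorem matrixSpectralRadius_le_of_le [Finite ι] [Finite κ] {A : Matrix ι ι ℝ} {B : Matrix κ κ ℝ}
    (hA : ∀ a b, 0 ≤ A a b) (hB : ∀ a b, 0 ≤ B a b) (φ : ι ↪ κ)
    (hAB : ∀ a b, A a b ≤ B (φ a) (φ b)) : matrixSpectralRadius A ≤ matrixSpectralRadius B := by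
  obtain ⟨T, hT, h⟩ := exists_isL2Operator_of_finite A
  obtain ⟨S, hS, h'⟩ := exists_isL2Operator_of_finite B
  rw [← h, ← h']
  exact spectralRadius_le_of_le hA hB hT hS φ hAB

theorem matrixSpectralRadius_le_l2 [Finite ι] {A : Matrix ι ι ℝ} {B : Matrix κ κ ℝ}
    (hA : ∀ a b, 0 ≤ A a b) (hB : ∀ a b, 0 ≤ B a b) (φ : ι ↪ κ)
    (hAB : ∀ a b, A a b ≤ B (φ a) (φ b)) : matrixSpectralRadius A ≤ l2SpectralRadius B := by
  obtain ⟨T, hT, h⟩ := exists_isL2Operator_of_finite A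
  rw [← h]
  exact le_iInf₂ fun S hS => spectralRadius_le_of_le hA hB hT hS φ hAB

/-- The norm of a symmetric nonnegative matrix is at most the spectral radius of any matrix
dominating it. -/
theorem formBound_of_symm_of_le [Finite ι] [Finite κ] {S : Matrix ι ι ℝ} {B : Matrix κ κ ℝ}
    (hS : ∀ a b, 0 ≤ S a b) (hsymm : ∀ a b, S a b = S b a) (hB : ∀ a b, 0 ≤ B a b) (φ : ι ↪ κ)
    (hSB : ∀ a b, S a b ≤ B (φ a) (φ b)) : FormBound S (matrixSpectralRadius B).toReal := by
  classical
  obtain ⟨T, hT, h⟩ := exists_isL2Operator_of_finite S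
  have hadj : IsL2Operator S (ContinuousLinearMap.adjoint T) := by
    intro a b
    have h1 : inner ℂ (lp.single (E := fun _ : ι => ℂ) 2 a (1 : ℂ))
        (ContinuousLinearMap.adjoint T (lp.single 2 b (1 : ℂ))) =
        inner ℂ (T (lp.single 2 a (1 : ℂ))) (lp.single (E := fun _ : ι => ℂ) 2 b (1 : ℂ)) :=
      ContinuousLinearMap.adjoint_inner_right _ _ _
    rw [lp.inner_single_left, lp.inner_single_right, hT.apply_single] at h1
    rw [hsymm a b]
    convert h1 using 1
    · simp only [RCLike.inner_apply, map_one, mul_one]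
    · simp
  -- Self-adjointness turns the norm into a spectral radius, which is monotone in the entries.
  have hsa : IsSelfAdjoint T := hadj.unique hT
  have h2 := hsa.spectralRadius_eq_nnnorm
  have h3 := matrixSpectralRadius_le_of_le hS hB φ hSB
  rw [← h, h2] at h3
  have h4 : ‖T‖ ≤ (matrixSpectralRadius B).toReal := by
    have := ENNReal.toReal_mono (matrixSpectralRadius_lt_top B).ne h3
    simpa using this
  intro s u g f hg hf
  refine (hT.formBound s u g f hg hf).trans ?_
  gcongr

theorem tpow_eq_pow [Fintype ι] [DecidableEq ι] (B : Matrix ι ι ℝ) (n : ℕ) :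
    tpow B n = B ^ n := by
  induction n with
  | zero => ext a b; simp [tpow, Matrix.one_apply]
  | succ n ih => ext a b; simp [tpow, ih, pow_succ, Matrix.mul_apply]

theorem matrixSpectralRadius_pow_mul_sum_le [Fintype ι] [DecidableEq ι] (B : Matrix ι ι ℝ)
    (n l : ℕ) : matrixSpectralRadius (B ^ n * ∑ k ∈ Finset.range (l + 1), B ^ k) ≤
      matrixSpectralRadius B ^ n * ∑ k ∈ Finset.range (l + 1), matrixSpectralRadius B ^ k := by
  obtain rfl : ‹DecidableEq ι› = fun a b => Classical.propDecidable (a = b) :=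
    Subsingleton.elim _ _
  classical
  obtain ⟨e, he⟩ := exists_algEquiv (ι := ι)
  have hm : ∀ C : Matrix ι ι ℝ, C.map (fun x : ℝ => (x : ℂ)) =
    (Complex.ofRealHom.mapMatrix : Matrix ι ι ℝ →+* Matrix ι ι ℂ) C := fun C => rfl
  rw [matrixSpectralRadius_eq (he B), matrixSpectralRadius_eq (he _)]
  refine le_trans (le_of_eq ?_) (spectralRadius_pow_mul_sum_le _ n l)
  congr 1
  rw [hm, hm]
  simp only [map_mul, map_pow, map_sum]

theorem FormBound.mono {B : Matrix ι ι ℝ} {C C' : ℝ} (h : FormBound B C) (hC : C ≤ C') :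
    FormBound B C' := by
  intro s u g f hg hf
  refine (h s u g f hg hf).trans ?_
  gcongr

/-- Each instance of the bound involves only finitely many indices. -/
theorem FormBound.of_exhaustion {B : Matrix ι ι ℝ} {C : ℝ}
    (h : ∀ F : Finset ι, ∃ P : Set ι, ↑F ⊆ P ∧
      FormBound (B.submatrix (Subtype.val : P → ι) Subtype.val) C) : FormBound B C := by
  classical
  intro s u g f hg hf
  obtain ⟨P, hP, hB⟩ := h (s ∪ u)
  have hs : ∀ x ∈ s, x ∈ P := fun x hx => hP (by simp [hx])
  have hu : ∀ x ∈ u, x ∈ P := fun x hx => hP (by simp [hx])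
  have h1 := hB (s.subtype (· ∈ P)) (u.subtype (· ∈ P)) (fun a => g a) (fun a => f a)
    (fun a => hg a) (fun a => hf a)
  simp only [Matrix.submatrix_apply] at h1
  rw [Finset.sum_subtype_of_mem (fun a => g a ^ 2) hs,
    Finset.sum_subtype_of_mem (fun a => f a ^ 2) hu,
    Finset.sum_subtype_of_mem (fun a => ∑ b ∈ u.subtype (· ∈ P), g a * B a b * f b) hs] at h1
  refine le_trans (le_of_eq (Finset.sum_congr rfl fun a _ => ?_)) h1
  rw [Finset.sum_subtype_of_mem (fun b => g a * B a b * f b) hu]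

theorem tpow_one (B : Matrix ι ι ℝ) : tpow B 1 = B := by
  classical
  ext a b
  simp only [tpow]
  rw [tsum_eq_single a fun c hc => by simp [Ne.symm hc]]
  simp

/-! ### The Hashimoto matrix, arc reversal and balls. -/

variable {V W : Type*} {G : SimpleGraph V} {G' : SimpleGraph W}

theorem hashimoto_nonneg {p : V → ℝ} (hp : ∀ v, 0 ≤ p v) (a b : G.Dart) :
    0 ≤ hashimoto G p a b := by
  unfold hashimoto; split_ifs
  exacts [hp _, le_rfl]

theorem OLGAdj.symm {a b : G.Dart} (h : OLGAdj a b) : OLGAdj b.symm a.symm :=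
  ⟨h.1.symm, fun h' => h.2 h'.symm⟩

/-- The weight sits at the vertex shared by the two arcs, which reversal preserves. -/
theorem hashimoto_symm (p : V → ℝ) (a b : G.Dart) :
    hashimoto G p b.symm a.symm = hashimoto G p a b := by
  unfold hashimoto
  by_cases h : OLGAdj a b
  · rw [if_pos h, if_pos h.symm, h.1]; rfl
  · rw [if_neg h, if_neg fun h' => h (by simpa using h'.symm)]

/-- The map on arcs induced by an injective graph homomorphism. -/
def dartEmbedding (f : G →g G') (hf : Function.Injective f) : G.Dart ↪ G'.Dart :=
  ⟨f.mapDart, fun a b h => by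
    have h1 := congrArg SimpleGraph.Dart.toProd h
    have h2 := congrArg Prod.fst h1
    have h3 := congrArg Prod.snd h1
    exact SimpleGraph.Dart.ext _ _ (Prod.ext (hf h2) (hf h3))⟩

theorem hashimoto_le_dartEmbedding (f : G →g G') (hf : Function.Injective f) {p : V → ℝ}
    {p' : W → ℝ} (hp : ∀ v, p' (f v) = p v) (hp0 : ∀ v, 0 ≤ p' v) (a b : G.Dart) :
    hashimoto G p a b ≤
      hashimoto G' p' (dartEmbedding f hf a) (dartEmbedding f hf b) := by
  by_cases h : OLGAdj a b
  · have h' : OLGAdj (dartEmbedding f hf a) (dartEmbedding f hf b) :=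
      ⟨congrArg f h.1, fun h' => h.2 (hf h')⟩
    unfold hashimoto
    rw [if_pos h, if_pos h']
    exact (hp a.snd).ge
  · conv_lhs => unfold hashimoto
    rw [if_neg h]
    exact hashimoto_nonneg hp0 _ _

/-- The arcs with both ends at distance at most `R` from `v₀`. -/
def ballDarts (G : SimpleGraph V) (v₀ : V) (R : ℕ) : Set G.Dart :=
  {a | G.dist v₀ a.fst ≤ R ∧ G.dist v₀ a.snd ≤ R}

/-- The principal submatrix of the Hashimoto matrix on the arcs of a ball. -/
noncomputable def ballHashimoto (G : SimpleGraph V) (p : V → ℝ) (v₀ : V) (R : ℕ) :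
    Matrix (ballDarts G v₀ R) (ballDarts G v₀ R) ℝ :=
  (hashimoto G p).submatrix Subtype.val Subtype.val

theorem ballHashimoto_nonneg {p : V → ℝ} (hp : ∀ v, 0 ≤ p v) (v₀ : V) (R : ℕ)
    (a b : ballDarts G v₀ R) : 0 ≤ ballHashimoto G p v₀ R a b :=
  hashimoto_nonneg hp _ _

theorem ballDarts_mono {v₀ : V} {R R' : ℕ} (h : R ≤ R') : ballDarts G v₀ R ⊆ ballDarts G v₀ R' :=
  fun _ ha => ⟨ha.1.trans h, ha.2.trans h⟩

theorem symm_mem_ballDarts {v₀ : V} {R : ℕ} {a : G.Dart} (h : a ∈ ballDarts G v₀ R) :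
    a.symm ∈ ballDarts G v₀ R := ⟨h.2, h.1⟩

/-- Arc reversal within a ball. -/
def ballSymm (G : SimpleGraph V) (v₀ : V) (R : ℕ) : Equiv.Perm (ballDarts G v₀ R) where
  toFun a := ⟨a.1.symm, symm_mem_ballDarts a.2⟩
  invFun a := ⟨a.1.symm, symm_mem_ballDarts a.2⟩
  left_inv a := by simp
  right_inv a := by simp

theorem dist_le_succ_of_adj (hG : G.Connected) (v₀ : V) {u v : V} (h : G.Adj u v) :
    G.dist v₀ v ≤ G.dist v₀ u + 1 := by
  have h1 := hG.dist_triangle (u := v₀) (v := u) (w := v)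
  rwa [SimpleGraph.dist_eq_one_iff_adj.2 h] at h1

theorem OLGAdj.mem_ballDarts_right (hG : G.Connected) {v₀ : V} {R : ℕ} {a b : G.Dart}
    (h : OLGAdj a b) (ha : a ∈ ballDarts G v₀ R) : b ∈ ballDarts G v₀ (R + 1) := by
  have h1 : G.dist v₀ b.fst ≤ R := h.1 ▸ ha.2
  exact ⟨by omega, (dist_le_succ_of_adj hG v₀ b.adj).trans (by omega)⟩

theorem OLGAdj.mem_ballDarts_left (hG : G.Connected) {v₀ : V} {R : ℕ} {a b : G.Dart}
    (h : OLGAdj a b) (hb : b ∈ ballDarts G v₀ R) : a ∈ ballDarts G v₀ (R + 1) := by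
  have := h.symm.mem_ballDarts_right hG (symm_mem_ballDarts hb)
  simpa using symm_mem_ballDarts this

theorem exists_subset_ballDarts (v₀ : V) (F : Finset G.Dart) :
    ∃ R, ↑F ⊆ ballDarts G v₀ R := by
  refine ⟨F.sup fun a => max (G.dist v₀ a.fst) (G.dist v₀ a.snd), fun a ha => ?_⟩
  have := Finset.le_sup (f := fun a : G.Dart => max (G.dist v₀ a.fst) (G.dist v₀ a.snd)) ha
  exact ⟨(le_max_left _ _).trans this, (le_max_right _ _).trans this⟩

/-- Deep inside a ball, the powers of the truncated matrix are those of the full matrix. -/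
theorem tpow_ballHashimoto (hG : G.Connected) (p : V → ℝ) (v₀ : V) {R : ℕ} (n : ℕ) :
    ∀ (r : ℕ) (a b : ballDarts G v₀ R), b.1 ∈ ballDarts G v₀ r → r + n ≤ R →
      tpow (ballHashimoto G p v₀ R) n a b = tpow (hashimoto G p) n a b := by
  induction n with
  | zero =>
    intro r a b _ _
    by_cases h : a = b
    · simp [tpow, h]
    · simp [tpow, h, Subtype.val_injective.ne h]
  | succ n ih =>
    intro r a b hb hr
    have hadj : ∀ c : G.Dart, hashimoto G p c b ≠ 0 → OLGAdj c b := by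
      intro c hc
      by_contra h
      exact hc (if_neg h)
    simp only [tpow]
    -- Only arcs `c` preceding `b` contribute, and these lie in the ball of radius `r + 1`, inside
    -- that of radius `R`.
    rw [← Subtype.val_injective.tsum_eq (g := (Subtype.val : ballDarts G v₀ R → G.Dart))]
    · refine tsum_congr fun c => ?_
      by_cases hc : hashimoto G p c b = 0
      · simp [ballHashimoto, hc]
      · rw [ih (r + 1) a c ((hadj c hc).mem_ballDarts_left hG hb) (by omega)]
        rfl
    · intro c hc
      have hc' : hashimoto G p c b ≠ 0 := fun h => hc (by simp [h])
      exact ⟨⟨c, ballDarts_mono (by omega) ((hadj c hc').mem_ballDarts_left hG hb)⟩, rfl⟩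

theorem HasNonBacktrackingWalk.exists_step {a b : G.Dart} {k : ℕ}
    (h : HasNonBacktrackingWalk a b (k + 1)) :
    ∃ c, OLGAdj a c ∧ HasNonBacktrackingWalk c b k := by
  obtain ⟨w, rfl, rfl, hw⟩ := h
  refine ⟨w 1, by simpa using hw 0, fun i => w i.succ, rfl, rfl, fun i => hw i.succ⟩

section Powers

variable [Fintype ι]

theorem matrix_mul_le_mul {A B : Matrix ι ι ℝ} (hA : ∀ a b, 0 ≤ A a b) (hB : ∀ a b, 0 ≤ B a b)
    (a b c : ι) : A a c * B c b ≤ (A * B) a b := by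
  rw [Matrix.mul_apply]
  exact Finset.single_le_sum (f := fun c => A a c * B c b)
    (fun d _ => mul_nonneg (hA a d) (hB d b)) (Finset.mem_univ c)

theorem matrix_pow_nonneg [DecidableEq ι] {A : Matrix ι ι ℝ} (hA : ∀ a b, 0 ≤ A a b) (n : ℕ)
    (a b : ι) : 0 ≤ (A ^ n) a b := by
  rw [← tpow_eq_pow]; exact tpow_nonneg hA n a b

theorem pow_submatrix_perm [DecidableEq ι] (A : Matrix ι ι ℝ) (σ : Equiv.Perm ι) (n : ℕ) :
    (A.submatrix σ σ) ^ n = (A ^ n).submatrix σ σ := by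
  induction n with
  | zero => simp
  | succ n ih => rw [pow_succ, pow_succ, ih, Matrix.submatrix_mul_equiv]

end Powers

/-- From `Aᵀ = σ A σ` follows `(A ^ n)ᵀ = σ A ^ n σ`, so `A ^ n σ` is symmetric although `A` is not.
-/
theorem ballHashimoto_pow_symm (p : V → ℝ) (v₀ : V) (R : ℕ) [Fintype (ballDarts G v₀ R)]
    [DecidableEq (ballDarts G v₀ R)] (n : ℕ) (a b : ballDarts G v₀ R) :
    (ballHashimoto G p v₀ R ^ n) a (ballSymm G v₀ R b) =
      (ballHashimoto G p v₀ R ^ n) b (ballSymm G v₀ R a) := by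
  have h : (ballHashimoto G p v₀ R).transpose =
      (ballHashimoto G p v₀ R).submatrix (ballSymm G v₀ R) (ballSymm G v₀ R) := by
    ext a b
    exact (hashimoto_symm p b.1 a.1).symm
  have h2 := congrArg (fun M => (M ^ n) (ballSymm G v₀ R b) a) h
  simp only [pow_submatrix_perm, ← Matrix.transpose_pow, Matrix.transpose_apply,
    Matrix.submatrix_apply] at h2
  exact h2

/-- Each step has weight at least `q`, and `k` steps from radius `r` cannot leave the ball of radius
`r + k`. -/
theorem pow_le_ballHashimoto_pow (hG : G.Connected) {p : V → ℝ} {q : ℝ} (hq : 0 ≤ q)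
    (hp : ∀ v, q ≤ p v) (v₀ : V) {R : ℕ} [Fintype (ballDarts G v₀ R)]
    [DecidableEq (ballDarts G v₀ R)] (k : ℕ) :
    ∀ (r : ℕ) (a b : ballDarts G v₀ R), a.1 ∈ ballDarts G v₀ r → r + k ≤ R →
      HasNonBacktrackingWalk a.1 b.1 k → q ^ k ≤ (ballHashimoto G p v₀ R ^ k) a b := by
  have hH := ballHashimoto_nonneg (G := G) (p := p) (fun v => hq.trans (hp v)) v₀ R
  induction k with
  | zero =>
    rintro r a b _ _ ⟨w, h0, h1, _⟩
    have : a = b := Subtype.ext (h0.symm.trans h1)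
    simp [this]
  | succ k ih =>
    intro r a b ha hr hw
    obtain ⟨c, hac, hcb⟩ := hw.exists_step
    have hc := hac.mem_ballDarts_right hG ha
    let c' : ballDarts G v₀ R := ⟨c, ballDarts_mono (by omega) hc⟩
    rw [pow_succ', pow_succ']
    refine le_trans (mul_le_mul ?_ (ih (r + 1) c' b hc (by omega) hcb) (by positivity) (hH _ _))
      (matrix_mul_le_mul hH (matrix_pow_nonneg hH k) a b c')
    change q ≤ hashimoto G p a.1 c
    rw [hashimoto, if_pos hac]
    exact hp _

/-! ### Norm bounds for powers, uniform in the radius. -/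

theorem formBound_tpow_ballHashimoto (hG : G.Connected) {p : V → ℝ} {q : ℝ} (hq : 0 < q)
    (hq1 : q ≤ 1) (hp : ∀ v, q ≤ p v) (v₀ : V) [∀ R, Finite (ballDarts G v₀ R)] {l : ℕ}
    (hl : ∀ a : G.Dart, ∃ k : ℕ, k ≤ l ∧ HasNonBacktrackingWalk a a.symm k) (n R : ℕ) :
    FormBound (tpow (ballHashimoto G p v₀ R) n)
      ((q ^ l)⁻¹ * ((matrixSpectralRadius (ballHashimoto G p v₀ (R + l))).toReal ^ n *
        ∑ k ∈ Finset.range (l + 1),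
          (matrixSpectralRadius (ballHashimoto G p v₀ (R + l))).toReal ^ k)) := by
  classical
  have _ : ∀ R, Fintype (ballDarts G v₀ R) := fun R => Fintype.ofFinite _
  have hH := ballHashimoto_nonneg (G := G) (p := p) (fun v => hq.le.trans (hp v)) v₀
  set A := ballHashimoto G p v₀ R with hA
  set B := ballHashimoto G p v₀ (R + l) with hB
  set ρ := matrixSpectralRadius B
  let σ := ballSymm G v₀ R
  let φ : ballDarts G v₀ R ↪ ballDarts G v₀ (R + l) :=
    ⟨fun a => ⟨a.1, ballDarts_mono (by omega) a.2⟩, fun a b h => Subtype.ext (by simpa using h)⟩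
  have hAn : ∀ a b, (A ^ n) a b ≤ (B ^ n) (φ a) (φ b) := by
    obtain ⟨T, hT, -⟩ := exists_isL2Operator_of_finite A
    obtain ⟨S, hS, -⟩ := exists_isL2Operator_of_finite B
    have := tpow_le_tpow (hH _) (hH _) hT hS φ (fun a b => le_rfl) n
    simpa only [tpow_eq_pow] using this
  have hK0 : ∀ a b, 0 ≤ (∑ k ∈ Finset.range (l + 1), B ^ k) a b := by
    intro a b
    rw [Matrix.sum_apply]
    exact Finset.sum_nonneg fun k _ => matrix_pow_nonneg (hH _) k a b
  -- The walk from `σ b` back to `b` fits in the enlarged ball; `q ≤ 1` replaces its length by `l`.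
  have hK : ∀ b, q ^ l ≤ (∑ k ∈ Finset.range (l + 1), B ^ k) (φ (σ b)) (φ b) := by
    intro b
    obtain ⟨k, hk, hw⟩ := hl (σ b).1
    have h1 : q ^ k ≤ (B ^ k) (φ (σ b)) (φ b) := by
      refine pow_le_ballHashimoto_pow hG hq.le hp v₀ k R _ _ (σ b).2 (by omega) ?_
      have : (σ b).1.symm = b.1 := by simp [σ, ballSymm]
      rwa [this] at hw
    rw [Matrix.sum_apply]
    refine (pow_le_pow_of_le_one hq.le hq1 hk).trans (h1.trans ?_)
    exact Finset.single_le_sum (f := fun k => (B ^ k) (φ (σ b)) (φ b))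
      (fun k _ => matrix_pow_nonneg (hH _) k _ _) (Finset.mem_range.2 (by omega))
  have hS : FormBound (fun a b => q ^ l * (A ^ n) a (σ b))
      (matrixSpectralRadius (B ^ n * ∑ k ∈ Finset.range (l + 1), B ^ k)).toReal := by
    refine formBound_of_symm_of_le (fun a b => ?_) (fun a b => ?_) (fun a b => ?_) φ fun a b => ?_
    · exact mul_nonneg (by positivity) (matrix_pow_nonneg (hH _) n _ _)
    · rw [ballHashimoto_pow_symm]
    · rw [Matrix.mul_apply]
      exact Finset.sum_nonneg fun c _ => mul_nonneg (matrix_pow_nonneg (hH _) n _ _) (hK0 _ _)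
    -- Keep only the intermediate arc `σ b` in the matrix product.
    · refine le_trans ?_ (matrix_mul_le_mul (matrix_pow_nonneg (hH _) n) hK0 _ _ (φ (σ b)))
      rw [mul_comm]
      exact mul_le_mul (hAn _ _) (hK b) (by positivity) (matrix_pow_nonneg (hH _) n _ _)
  have hρ : ρ ≠ ⊤ := (matrixSpectralRadius_lt_top B).ne
  have hle : (matrixSpectralRadius (B ^ n * ∑ k ∈ Finset.range (l + 1), B ^ k)).toReal ≤
      ρ.toReal ^ n * ∑ k ∈ Finset.range (l + 1), ρ.toReal ^ k := by
    have h1 := matrixSpectralRadius_pow_mul_sum_le B n l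
    have h2 : ρ ^ n * ∑ k ∈ Finset.range (l + 1), ρ ^ k ≠ ⊤ :=
      ENNReal.mul_ne_top (ENNReal.pow_ne_top hρ)
        (ENNReal.sum_ne_top.2 fun k _ => ENNReal.pow_ne_top hρ)
    refine (ENNReal.toReal_mono h2 h1).trans_eq ?_
    rw [ENNReal.toReal_mul, ENNReal.toReal_sum fun k _ => ENNReal.pow_ne_top hρ]
    simp only [ENNReal.toReal_pow]
  have h3 := (FormBound.const_mul_iff (B := fun a b => (A ^ n) a (σ b))
    (C := (q ^ l)⁻¹ * (ρ.toReal ^ n * ∑ k ∈ Finset.range (l + 1), ρ.toReal ^ k))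
    (pow_pos hq l)).1 (hS.mono (by rwa [mul_inv_cancel_left₀ (pow_pos hq l).ne']))
  rw [tpow_eq_pow]
  -- Undo the reversal of the column index.
  refine h3.of_le (Function.Embedding.refl _) σ.symm.toEmbedding fun a b => ?_
  simp

/-- The `ℓ²` spectral radius of the Hashimoto matrix is approximated by balls. -/
theorem l2SpectralRadius_le_iSup (hG : G.Connected) {p : V → ℝ} {q : ℝ} (hq : 0 < q)
    (hq1 : q ≤ 1) (hp : ∀ v, q ≤ p v) (v₀ : V) [∀ R, Finite (ballDarts G v₀ R)]
    (hloc : LocallyStronglyConnectedOLG G) :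
    l2SpectralRadius (hashimoto G p) ≤ ⨆ R, matrixSpectralRadius (ballHashimoto G p v₀ R) := by
  obtain ⟨l, hl⟩ := hloc
  set L := ⨆ R, matrixSpectralRadius (ballHashimoto G p v₀ R) with hL
  by_cases htop : L = ⊤
  · rw [htop]; exact le_top
  have hH := hashimoto_nonneg (G := G) (p := p) (fun v => hq.le.trans (hp v))
  set M : ℝ := (q ^ l)⁻¹ * ∑ k ∈ Finset.range (l + 1), L.toReal ^ k with hM
  have hM0 : 0 < M := by
    refine mul_pos (by positivity) (Finset.sum_pos' (fun k _ => by positivity) ⟨0, by simp, ?_⟩)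
    simp
  have hb : ∀ n, FormBound (tpow (hashimoto G p) n) (M * L.toReal ^ n) := by
    intro n
    refine FormBound.of_exhaustion fun F => ?_
    obtain ⟨r, hr⟩ := exists_subset_ballDarts v₀ F
    refine ⟨ballDarts G v₀ r, hr, ?_⟩
    have hle : (matrixSpectralRadius (ballHashimoto G p v₀ (r + n + l))).toReal ≤ L.toReal :=
      ENNReal.toReal_mono htop
        (le_iSup (fun R => matrixSpectralRadius (ballHashimoto G p v₀ R)) _)
    -- The margin `n` makes the truncated `n`-th power exact on the ball of radius `r`; the margin
    -- `l` holds the returning walks.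
    have h1 := (formBound_tpow_ballHashimoto hG hq hq1 hp v₀ hl n (r + n)).mono
      (C' := M * L.toReal ^ n) (by
        rw [hM, mul_assoc, mul_comm (∑ k ∈ Finset.range (l + 1), L.toReal ^ k)]
        gcongr)
    let φ : ballDarts G v₀ r ↪ ballDarts G v₀ (r + n) :=
      ⟨fun a => ⟨a.1, ballDarts_mono (by omega) a.2⟩, fun a b h => Subtype.ext (by simpa using h)⟩
    exact h1.of_le φ φ fun a b =>
      (tpow_ballHashimoto hG p v₀ n r (φ a) (φ b) b.2 le_rfl).ge
  -- The case `n = 1` gives boundedness of `H`; an unbounded `H` thus forces `L = ⊤`.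
  have h1 := hb 1
  rw [tpow_one] at h1
  obtain ⟨T, hT, -⟩ := h1.exists_operator hH (by positivity)
  rw [l2SpectralRadius_eq hT, ← ENNReal.ofReal_toReal htop]
  exact spectralRadius_le_of_norm_pow_le T hM0 ENNReal.toReal_nonneg fun n =>
    (hT.tpow n).norm_le (tpow_nonneg hH n) (by positivity) (hb n)

/-! ### Comparison with the finite subgraphs and the limit. -/

theorem mem_ball_iff_dist_le (hG : G.Connected) (v₀ v : V) (R : ℕ) :
    G.edist v₀ v ≤ R ↔ G.dist v₀ v ≤ R := by
  rw [← (hG v₀ v).coe_dist_eq_edist, Nat.cast_le]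

/-- The arcs of a ball as arcs of the induced subgraph. -/
def ballDartsEmbedding (hG : G.Connected) (v₀ : V) (R : ℕ) :
    ballDarts G v₀ R ↪ (G.induce {v | G.edist v₀ v ≤ R}).Dart :=
  ⟨fun a => ⟨(⟨a.1.fst, (mem_ball_iff_dist_le hG v₀ _ R).2 a.2.1⟩,
      ⟨a.1.snd, (mem_ball_iff_dist_le hG v₀ _ R).2 a.2.2⟩), a.1.adj⟩,
    fun a b h => by
      have h1 := congrArg SimpleGraph.Dart.toProd h
      exact Subtype.ext (SimpleGraph.Dart.ext _ _ (Prod.ext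
        (congrArg (fun x => x.1.1) h1) (congrArg (fun x => x.2.1) h1)))⟩

theorem ballHashimoto_le_induce (hG : G.Connected) {p : V → ℝ} (hp : ∀ v, 0 ≤ p v) (v₀ : V)
    (R : ℕ) (a b : ballDarts G v₀ R) :
    ballHashimoto G p v₀ R a b ≤
      hashimoto (G.induce {v | G.edist v₀ v ≤ R}) (fun v => p v)
        (ballDartsEmbedding hG v₀ R a) (ballDartsEmbedding hG v₀ R b) := by
  by_cases h : OLGAdj a.1 b.1
  · have h' : OLGAdj (ballDartsEmbedding hG v₀ R a) (ballDartsEmbedding hG v₀ R b) :=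
      ⟨Subtype.ext h.1, fun h' => h.2 (congrArg Subtype.val h')⟩
    change hashimoto G p a.1 b.1 ≤ _
    unfold hashimoto
    rw [if_pos h, if_pos h']
    rfl
  · change hashimoto G p a.1 b.1 ≤ _
    conv_lhs => unfold hashimoto
    rw [if_neg h]
    exact hashimoto_nonneg (p := fun v : {v | G.edist v₀ v ≤ R} => p v) (fun v => hp v) _ _

end SitePercolation

theorem mainTheorem10 {V : Type*} [Infinite V] (G : SimpleGraph V) (hG : G.Connected)
    (hloc : SitePercolation.LocallyStronglyConnectedOLG G)
    (p : V → ℝ) (p_min : ℝ) (hp_min : 0 < p_min) (hp_lower : ∀ v, p_min < p v)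
    (hp_upper : ∀ v, p v ≤ 1)
    (Gt : ℕ → G.Subgraph) [∀ t, Finite (Gt t).verts]
    (hmono : ∀ t, Gt t ≤ Gt (t + 1))
    (hleaf : ∀ t, ∀ v ∈ (Gt t).verts, ((Gt t).neighborSet v).ncard ≠ 1)
    (v₀ : V)
    (hconv : SitePercolation.ConvergesNear G p v₀
      (fun t => (Gt t).coe) (fun t (v : (Gt t).verts) => p v)) :
    Filter.Tendsto
      (fun t => SitePercolation.matrixSpectralRadius
        (SitePercolation.hashimoto (Gt t).coe (fun v : (Gt t).verts => p v)))
      Filter.atTop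
      (nhds (SitePercolation.l2SpectralRadius (SitePercolation.hashimoto G p))) := by
  open SitePercolation in
  have hp0 : ∀ v, 0 ≤ p v := fun v => (hp_min.trans (hp_lower v)).le
  -- Balls are finite because they embed in some finite `Gt t`.
  have hfin : ∀ R, Finite (ballDarts G v₀ R) := by
    intro R
    obtain ⟨t₀, h⟩ := hconv R
    obtain ⟨f, -⟩ := h t₀ le_rfl
    have : Finite {v | G.edist v₀ v ≤ R} := Finite.of_injective f f.injective'
    exact Finite.of_injective _ (ballDartsEmbedding hG v₀ R).injective
  have hupper : ∀ t, matrixSpectralRadius (hashimoto (Gt t).coe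
      (fun v : (Gt t).verts => p v)) ≤ l2SpectralRadius (hashimoto G p) := fun t =>
    matrixSpectralRadius_le_l2 (hashimoto_nonneg fun v => hp0 v) (hashimoto_nonneg hp0)
      (dartEmbedding (Gt t).hom (Gt t).hom_injective)
      (hashimoto_le_dartEmbedding (Gt t).hom (Gt t).hom_injective (fun v => rfl) hp0)
  have hlower : ∀ R, ∃ t₀, ∀ t ≥ t₀, matrixSpectralRadius (ballHashimoto G p v₀ R) ≤
      matrixSpectralRadius (hashimoto (Gt t).coe (fun v : (Gt t).verts => p v)) := by
    intro R
    obtain ⟨t₀, h⟩ := hconv R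
    refine ⟨t₀, fun t ht => ?_⟩
    obtain ⟨f, hf⟩ := h t ht
    refine matrixSpectralRadius_le_of_le (ballHashimoto_nonneg hp0 v₀ R)
      (hashimoto_nonneg fun v => hp0 v)
      ((ballDartsEmbedding hG v₀ R).trans (dartEmbedding f.toHom f.injective')) fun a b => ?_
    exact (ballHashimoto_le_induce hG hp0 v₀ R a b).trans
      (hashimoto_le_dartEmbedding f.toHom f.injective' hf (fun v => hp0 v) _ _)
  have hq1 : p_min ≤ 1 := (hp_lower v₀).le.trans (hp_upper v₀)
  have hsup := l2SpectralRadius_le_iSup hG hp_min hq1 (fun v => (hp_lower v).le) v₀ hloc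
  refine tendsto_order.2 ⟨fun x hx => ?_, fun x hx => Eventually.of_forall fun t =>
    (hupper t).trans_lt hx⟩
  obtain ⟨R, hR⟩ := lt_iSup_iff.1 (hx.trans_le hsup)
  obtain ⟨t₀, ht₀⟩ := hlower R
  filter_upwards [eventually_ge_atTop t₀] with t ht
  exact hR.trans_le (ht₀ t ht)
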